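/- For $d\in\mathbb{N}$, a $d$-dimensional continuous VASS with resets consists of a finite set $Q$ of control states and a finite set $T$ of transitions $(p,\mathbf{A},\mathbf{b},q)$ with $p,q\in Q$, $\mathbf{b}\in\mathbb{Z}^d$ and $\mathbf{A}$ a $d\times d$ diagonal matrix with entries in $\{0,1\}$. A configuration $p(\mathbf{u})$ consists of a state $p\in Q$ and a vector $\mathbf{u}\in\mathbb{Q}_{\ge 0}^d$. There is a step from $p(\mathbf{u})$ to $q(\mathbf{v})$ if $\mathbf{v}=\mathbf{A}\mathbf{u}+\alpha\mathbf{b}$ for some transition $(p,\mathbf{A},\mathbf{b},q)\in T$ and some rational $\alpha\in(0,1]$; and $p(\mathbf{u})$ can cover $q(\mathbf{v})$ if some finite (possibly empty) sequence of steps leads from $p(\mathbf{u})$ to a configuration $q(\mathbf{v}')$ with $\mathbf{v}'\ge\mathbf{v}$ componentwise. **Theorem.** The coverability problem for continuous VASS with resets is undecidable: there is no algorithm which, given $d$, a $d$-dimensional continuous VASS with resets and two of its configurations $p(\mathbf{u})$ and $q(\mathbf{v})$, decides whether $p(\mathbf{u})$ can cover $q(\mathbf{v})$. -/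

import Mathlib

namespace ContVASS

/-- A transition `(p, A, b, q)` of a `d`-dimensional affine continuous VASS with states `Q`. -/
structure Transition (Q : Type) (d : ℕ) where
  src : Q
  mat : Matrix (Fin d) (Fin d) ℤ
  upd : Fin d → ℤ
  tgt : Q

/-- A `d`-affine continuous VASS with finite set of control states `Q`: a finite set of
transitions. -/
structure AffineVASS (Q : Type) [Finite Q] (d : ℕ) where
  trans : Set (Transition Q d)
  finite_trans : trans.Finite

/-- A configuration `p(u)`: a control state and a vector of non-negative rational counter
values. -/
structure Config (Q : Type) (d : ℕ) where
  state : Q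
  val : Fin d → ℚ≥0

/-- The step `p(u) → q(v)` by means of the pair `α t`: `v = A u + α b` (as `val` takes values in
the non-negative rationals, this includes the requirement `A u + α b ≥ 0`). -/
def StepBy {Q : Type} {d : ℕ} (α : ℚ) (t : Transition Q d) (C D : Config Q d) : Prop :=
  t.src = C.state ∧ t.tgt = D.state ∧
    (fun i => (D.val i : ℚ)) =
      Matrix.mulVec (t.mat.map (fun z : ℤ => (z : ℚ))) (fun i => (C.val i : ℚ))
        + α • (fun i => (t.upd i : ℚ))

/-- One step: some transition of the machine is fired with some fraction `α ∈ (0, 1]`. -/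
def AffineVASS.Step {Q : Type} [Finite Q] {d : ℕ} (M : AffineVASS Q d) (C D : Config Q d) : Prop :=
  ∃ α : ℚ, 0 < α ∧ α ≤ 1 ∧ ∃ t ∈ M.trans, StepBy α t C D

/-- `C` can reach `D` by a finite (possibly empty) sequence of steps. -/
def AffineVASS.Reaches {Q : Type} [Finite Q] {d : ℕ} (M : AffineVASS Q d) (C D : Config Q d) :
    Prop :=
  Relation.ReflTransGen M.Step C D

/-- `C = p(u)` can cover `D = q(v)`: it can reach some `q(v')` with `v' ≥ v`. -/
def AffineVASS.Covers {Q : Type} [Finite Q] {d : ℕ} (M : AffineVASS Q d) (C D : Config Q d) :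
    Prop :=
  ∃ D' : Config Q d, M.Reaches C D' ∧ D'.state = D.state ∧ ∀ i, D.val i ≤ D'.val i

/-- The reset matrices: all diagonal matrices with entries in `{0, 1}`, in every dimension. -/
def resetMatrices (d : ℕ) : Set (Matrix (Fin d) (Fin d) ℤ) :=
  {A | A.IsDiag ∧ ∀ i, A i i = 0 ∨ A i i = 1}

/-- An input of the coverability problem for a family `𝒞` of matrices: a machine with states
`0, …, n - 1`, with `d` counters and with a finite list of transitions all of whose matrices
are in `𝒞`, and two configurations `source` and `target`. -/
structure CoverInput (𝒞 : ∀ d : ℕ, Set (Matrix (Fin d) (Fin d) ℤ)) where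
  n : ℕ
  d : ℕ
  trans : List (Transition (Fin n) d)
  mat_mem : ∀ t ∈ trans, t.mat ∈ 𝒞 d
  source : Config (Fin n) d
  target : Config (Fin n) d

/-- The machine of an input. -/
def CoverInput.machine {𝒞 : ∀ d : ℕ, Set (Matrix (Fin d) (Fin d) ℤ)} (I : CoverInput 𝒞) :
    AffineVASS (Fin I.n) I.d where
  trans := {t | t ∈ I.trans}
  finite_trans := I.trans.finite_toSet

/-- The question asked about an input. -/
def CoverInput.Holds {𝒞 : ∀ d : ℕ, Set (Matrix (Fin d) (Fin d) ℤ)} (I : CoverInput 𝒞) : Prop :=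
  I.machine.Covers I.source I.target

/-! ### Explicit finite descriptions of inputs -/

/-- An integer is written as the pair of its positive part and its negative part. -/
def codeInt (z : ℤ) : ℕ × ℕ := (z.toNat, (-z).toNat)

/-- A non-negative rational is written as numerator and denominator in lowest terms. -/
def codeRat (x : ℚ≥0) : ℕ × ℕ := (x.num, x.den)

/-- A transition is written as source state, list of matrix rows, update vector, target state. -/
def codeTransition {n d : ℕ} (t : Transition (Fin n) d) :
    ℕ × List (List (ℕ × ℕ)) × List (ℕ × ℕ) × ℕ :=
  (t.src.val, List.ofFn (fun i => List.ofFn (fun j => codeInt (t.mat i j))),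
    List.ofFn (fun i => codeInt (t.upd i)), t.tgt.val)

/-- A configuration is written as its state and the list of its counter values. -/
def codeConfig {n d : ℕ} (C : Config (Fin n) d) : ℕ × List (ℕ × ℕ) :=
  (C.state.val, List.ofFn (fun i => codeRat (C.val i)))

/-- The type of descriptions of inputs: number of states, number of counters, list of
transitions, source configuration, target configuration. -/
abbrev InputCode : Type :=
  ℕ × ℕ × List (ℕ × List (List (ℕ × ℕ)) × List (ℕ × ℕ) × ℕ) ×
    (ℕ × List (ℕ × ℕ)) × (ℕ × List (ℕ × ℕ))

/-- The description of an input. -/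
def CoverInput.code {𝒞 : ∀ d : ℕ, Set (Matrix (Fin d) (Fin d) ℤ)} (I : CoverInput 𝒞) :
    InputCode :=
  (I.n, I.d, I.trans.map codeTransition, codeConfig I.source, codeConfig I.target)

theorem codeInt_injective : Function.Injective codeInt := by
  intro a b h
  simp only [codeInt, Prod.mk.injEq] at h
  omega

theorem codeRat_injective : Function.Injective codeRat := by
  intro a b h
  simp only [codeRat, Prod.mk.injEq] at h
  exact NNRat.ext_num_den h.1 h.2

theorem codeTransition_injective {n d : ℕ} :
    Function.Injective (codeTransition : Transition (Fin n) d → _) := by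
  rintro ⟨p, A, b, q⟩ ⟨p', A', b', q'⟩ h
  simp only [codeTransition, Prod.mk.injEq, List.ofFn_inj, funext_iff] at h
  obtain ⟨h1, h2, h3, h4⟩ := h
  obtain rfl := Fin.ext h1
  obtain rfl := Fin.ext h4
  obtain rfl : A = A' := Matrix.ext fun i j => codeInt_injective (h2 i j)
  obtain rfl : b = b' := funext fun i => codeInt_injective (h3 i)
  rfl

theorem codeConfig_injective {n d : ℕ} :
    Function.Injective (codeConfig : Config (Fin n) d → _) := by
  rintro ⟨p, u⟩ ⟨p', u'⟩ h
  simp only [codeConfig, Prod.mk.injEq, List.ofFn_inj, funext_iff] at h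
  obtain ⟨h1, h2⟩ := h
  obtain rfl := Fin.ext h1
  obtain rfl : u = u' := funext fun i => codeRat_injective (h2 i)
  rfl

/-- Different inputs have different descriptions. -/
theorem CoverInput.code_injective {𝒞 : ∀ d : ℕ, Set (Matrix (Fin d) (Fin d) ℤ)} :
    Function.Injective (CoverInput.code : CoverInput 𝒞 → InputCode) := by
  rintro ⟨n, d, T, hT, C, D⟩ ⟨n', d', T', hT', C', D'⟩ h
  simp only [CoverInput.code, Prod.mk.injEq] at h
  obtain ⟨rfl, rfl, h1, h2, h3⟩ := h
  obtain rfl := List.map_injective_iff.2 codeTransition_injective h1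
  obtain rfl := codeConfig_injective h2
  obtain rfl := codeConfig_injective h3
  rfl

/-- The coverability problem for `𝒞`-continuous VASS is decidable: there is a total computable
function that, given the description of any input, answers whether the source configuration
can cover the target configuration. -/
def CoverabilityDecidable (𝒞 : ∀ d : ℕ, Set (Matrix (Fin d) (Fin d) ℤ)) : Prop :=
  ∃ f : InputCode → Bool, Computable f ∧ ∀ I : CoverInput 𝒞, f I.code = true ↔ I.Holds

end ContVASS

/-!
The halting problem is reduced to coverability. Coverability is a monotone question, and in a
continuous VASS even the fractions of the transitions are not under control, so exactness has to be
forced. This is done by conservation of mass: all update vectors of the constructed machines have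
sum `0`, hence the sum of all counters never grows, and it decreases exactly when a reset hits a
counter that is not `0`. If the target asks for the whole initial mass, then all the resets on the
way were zero tests (`DrainMachine.toInput_holds_iff`). Firing a transition several times and then
testing a counter for zero removes the choice of the fractions, since the amount of the transition
that empties the counter is determined. So the machines compute with *drains*: the multiple of a
vector is added that makes a given counter vanish, provided that the result is non-negative. This
is the model `DrainMachine`.

Drains can simulate a Turing machine (`simulation_halts_iff`). Each half of the tape is an expansion
`x = ∑ dᵢ / B ^ i` in a fixed base, stored together with its complement `1 - x`; a further counter
holds the unit `1`. To push the digit `a`, that is to pass to `(a + x) / B`, and to pop the digit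
`b`, that is to pass to `B * y - b`, are affine maps with fixed integer data, and a few drains perform
them. The popped digit is guessed. As the digits are even, a wrong guess makes `B * y - b` or its
complement negative, so the run gets stuck (`SymbolCode.eq_head_of_mem`).

Finally, a single universal Turing machine is fixed (`exists_universal_machine`), so that the states
and transitions of the VASS are constant and the inputs differ in two counter values of the source
only. These are computable (`computable_code_simulation`): by taking the inputs of the universal
machine of the form `2 ^ k - 1`, whose binary digits are all equal, the initial tape is unary.
-/

namespace ContVASS

/-! ### Firing transitions -/

/-- The counter values of a configuration as a vector of rationals. -/
def Config.vec {Q : Type} {d : ℕ} (C : Config Q d) : Fin d → ℚ := fun i => (C.val i : ℚ)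

/-- The configuration with a given vector of counter values; negative entries are truncated
to `0`. -/
def Config.ofVec {Q : Type} {d : ℕ} (q : Q) (u : Fin d → ℚ) : Config Q d :=
  ⟨q, fun i => (u i).toNNRat⟩

section Config

variable {Q : Type} {d : ℕ}

theorem Config.vec_nonneg (C : Config Q d) : 0 ≤ C.vec := fun i => (C.val i).2

@[simp]
theorem Config.ofVec_state (q : Q) (u : Fin d → ℚ) : (ofVec q u).state = q := rfl

theorem Config.vec_ofVec (q : Q) {u : Fin d → ℚ} (hu : 0 ≤ u) : (ofVec q u).vec = u :=
  funext fun i => Rat.coe_toNNRat _ (hu i)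

theorem stepBy_one_iff {p q : Q} {b : Fin d → ℤ} {α : ℚ} {C D : Config Q d} :
    StepBy α ⟨p, 1, b, q⟩ C D ↔
      p = C.state ∧ q = D.state ∧ D.vec = C.vec + α • (fun i => (b i : ℚ)) := by
  simp only [StepBy]
  rw [Matrix.map_one _ Int.cast_zero Int.cast_one, Matrix.one_mulVec]
  rfl

/-- Replacing the `z`-th entry of a vector by `0`. -/
def resetAt (z : Fin d) (u : Fin d → ℚ) : Fin d → ℚ := fun i => if i = z then 0 else u i

/-- The diagonal matrix that resets the counter `z`. -/
def resetMatrix (z : Fin d) : Matrix (Fin d) (Fin d) ℤ :=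
  Matrix.diagonal fun i => if i = z then 0 else 1

theorem stepBy_reset_iff {p q : Q} {z : Fin d} {α : ℚ} {C D : Config Q d} :
    StepBy α ⟨p, resetMatrix z, 0, q⟩ C D ↔
      p = C.state ∧ q = D.state ∧ D.vec = resetAt z C.vec := by
  simp only [StepBy, resetMatrix]
  rw [Matrix.diagonal_map Int.cast_zero]
  have : (Matrix.diagonal (fun i => ((if i = z then 0 else 1 : ℤ) : ℚ))).mulVec C.vec +
      α • (fun i => (((0 : Fin d → ℤ) i : ℤ) : ℚ)) = resetAt z C.vec := by
    funext i
    simp [Matrix.mulVec_diagonal, resetAt]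
  rw [← this]
  rfl

theorem one_mem_resetMatrices : (1 : Matrix (Fin d) (Fin d) ℤ) ∈ resetMatrices d :=
  ⟨Matrix.isDiag_one, fun i => Or.inr (by simp)⟩

theorem resetMatrix_mem_resetMatrices (z : Fin d) : resetMatrix z ∈ resetMatrices d := by
  refine ⟨Matrix.isDiag_diagonal _, fun i => ?_⟩
  by_cases h : i = z <;> simp [resetMatrix, h]

theorem sum_resetAt (z : Fin d) (u : Fin d → ℚ) : ∑ i, resetAt z u i = ∑ i, u i - u z := by
  have h : ∀ i, resetAt z u i = u i - if i = z then u i else 0 := fun i => by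
    by_cases h : i = z <;> simp [resetAt, h]
  simp [h, Finset.sum_sub_distrib]

/-- Firing a loop without reset again and again adds any non-negative rational multiple of its
update vector, as long as the result is non-negative: by convexity all the intermediate
configurations are non-negative as well. -/
theorem AffineVASS.reaches_loop [Finite Q] (M : AffineVASS Q d) {p : Q} {b : Fin d → ℤ}
    (hb : ⟨p, 1, b, p⟩ ∈ M.trans) {u : Fin d → ℚ} {t : ℚ} (hu : 0 ≤ u) (ht : 0 ≤ t)
    (hv : 0 ≤ u + t • (fun i => (b i : ℚ))) :
    M.Reaches (Config.ofVec p u) (Config.ofVec p (u + t • (fun i => (b i : ℚ)))) := by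
  obtain ⟨n, hn⟩ := exists_nat_ge t
  induction n generalizing u t with
  | zero =>
    obtain rfl : t = 0 := le_antisymm (by simpa using hn) ht
    simp [Reaches, Relation.ReflTransGen.refl]
  | succ n ih =>
    have fire : ∀ {w : Fin d → ℚ} {α : ℚ}, 0 ≤ w → 0 < α → α ≤ 1 →
        0 ≤ w + α • (fun i => (b i : ℚ)) →
        M.Step (Config.ofVec p w) (Config.ofVec p (w + α • (fun i => (b i : ℚ)))) :=
      fun hw h0 h1 hw' => ⟨_, h0, h1, _, hb, stepBy_one_iff.2
        ⟨rfl, rfl, by rw [Config.vec_ofVec _ hw, Config.vec_ofVec _ hw']⟩⟩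
    rcases le_or_gt t 1 with h1 | h1
    · rcases ht.eq_or_lt with rfl | h0
      · simp [Reaches, Relation.ReflTransGen.refl]
      · exact Relation.ReflTransGen.single (fire hu h0 h1 hv)
    · have hw : 0 ≤ u + (1 : ℚ) • (fun i => (b i : ℚ)) := fun i => by
        have h2 := hu i
        have h3 := hv i
        simp only [Pi.zero_apply, Pi.add_apply, Pi.smul_apply, smul_eq_mul, one_mul] at h2 h3 ⊢
        by_contra! h4
        nlinarith
      have e : u + t • (fun i => (b i : ℚ)) =
          (u + (1 : ℚ) • (fun i => (b i : ℚ))) + (t - 1) • (fun i => (b i : ℚ)) := by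
        module
      rw [e] at hv ⊢
      push_cast at hn
      exact Relation.ReflTransGen.head (fire hu one_pos le_rfl hw)
        (ih hw (by linarith) hv (by linarith))

end Config

/-! ### Drain machines -/

/-- A drain machine: in the control state `s` the counter `pivot s` is drained completely along
the vector `dir s`, which preserves the sum of all counters, and then the control state changes
to some `s'` with `next s s'`. -/
structure DrainMachine (S : Type) (d : ℕ) where
  pivot : S → Fin d
  dir : S → Fin d → ℤ
  next : S → S → Prop
  dir_pivot_neg : ∀ s, dir s (pivot s) < 0
  sum_dir : ∀ s, ∑ i, dir s i = 0

namespace DrainMachine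

variable {S : Type} {d : ℕ} (M : DrainMachine S d)

/-- The direction of a drain as a rational vector. -/
def dirQ (s : S) : Fin d → ℚ := fun i => (M.dir s i : ℚ)

/-- The effect of the drain at the state `s`: the multiple of `dir s` is added that makes the
pivot vanish. -/
def drain (s : S) (u : Fin d → ℚ) : Fin d → ℚ :=
  u + (u (M.pivot s) / -M.dirQ s (M.pivot s)) • M.dirQ s

/-- A step of a drain machine; it is possible only if the result of the drain is non-negative. -/
def Step (x y : S × (Fin d → ℚ)) : Prop :=
  M.next x.1 y.1 ∧ y.2 = M.drain x.1 x.2 ∧ 0 ≤ y.2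

/-- Reachability by a finite number of drains. -/
def Reaches : S × (Fin d → ℚ) → S × (Fin d → ℚ) → Prop := Relation.ReflTransGen M.Step

/-- A control state without successor; its own drain is never performed. -/
def Terminal (s : S) : Prop := ∀ s', ¬ M.next s s'

/-- From `x` a terminal control state is reachable. -/
def Halts (x : S × (Fin d → ℚ)) : Prop := ∃ y, M.Reaches x y ∧ M.Terminal y.1

theorem dirQ_pivot_neg (s : S) : M.dirQ s (M.pivot s) < 0 :=
  Int.cast_lt_zero.2 (M.dir_pivot_neg s)

theorem sum_dirQ (s : S) : ∑ i, M.dirQ s i = 0 := by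
  simp only [dirQ]
  exact_mod_cast M.sum_dir s

theorem drain_pivot (s : S) (u : Fin d → ℚ) : M.drain s u (M.pivot s) = 0 := by
  have := (M.dirQ_pivot_neg s).ne
  simp only [drain, Pi.add_apply, Pi.smul_apply, smul_eq_mul]
  field_simp
  ring

/-- The pivot determines how far the vector has moved along the direction of the drain. -/
theorem add_smul_dirQ_eq_drain {s : S} {u : Fin d → ℚ} {t : ℚ}
    (h : (u + t • M.dirQ s) (M.pivot s) = 0) : u + t • M.dirQ s = M.drain s u := by
  have h0 := (M.dirQ_pivot_neg s).ne
  have : t = u (M.pivot s) / -M.dirQ s (M.pivot s) := by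
    simp only [Pi.add_apply, Pi.smul_apply, smul_eq_mul] at h
    rw [eq_div_iff (neg_ne_zero.2 h0)]
    linarith
  rw [drain, ← this]

theorem sum_add_smul_dirQ (s : S) (u : Fin d → ℚ) (t : ℚ) :
    ∑ i, (u + t • M.dirQ s) i = ∑ i, u i := by
  simp [Finset.sum_add_distrib, ← Finset.mul_sum, sum_dirQ]

theorem Reaches.sum_eq {M : DrainMachine S d} {x y : S × (Fin d → ℚ)} (h : M.Reaches x y) :
    ∑ i, y.2 i = ∑ i, x.2 i := by
  induction h with
  | refl => rfl
  | tail _ h ih => rw [h.2.1, drain, sum_add_smul_dirQ, ih]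

theorem Reaches.nonneg {M : DrainMachine S d} {x y : S × (Fin d → ℚ)} (h : M.Reaches x y)
    (hx : 0 ≤ x.2) : 0 ≤ y.2 := by
  induction h with
  | refl => exact hx
  | tail _ h _ => exact h.2.2

/-! ### Drain machines as continuous VASS with resets -/

variable [Finite S]

/-- The number of control states of the VASS of a drain machine: there is one more state, which
is entered from the terminal states. -/
noncomputable def size (S : Type) : ℕ := Nat.card (Option S)

/-- The numbering of the control states of the VASS of a drain machine. -/
noncomputable def num : Option S ≃ Fin (size S) := Finite.equivFin _

/-- In the state `s`, the direction of `s` can be added. -/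
noncomputable def loopTrans (s : S) : Transition (Fin (size S)) d :=
  ⟨num (some s), 1, M.dir s, num (some s)⟩

/-- On leaving the state `s`, the pivot of `s` is reset. -/
noncomputable def exitTrans (s s' : S) : Transition (Fin (size S)) d :=
  ⟨num (some s), resetMatrix (M.pivot s), 0, num (some s')⟩

/-- The extra state can be entered from the state `s`. -/
noncomputable def stopTrans (d : ℕ) (s : S) : Transition (Fin (size S)) d :=
  ⟨num (some s), 1, 0, num none⟩

/-- In the extra state, everything can be moved to the counter `c`. -/
noncomputable def gatherTrans (S : Type) [Finite S] (c i : Fin d) : Transition (Fin (size S)) d :=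
  ⟨num none, 1, Pi.single c 1 - Pi.single i 1, num none⟩

/-- The transitions of the VASS of a drain machine. -/
def transSet (c : Fin d) : Set (Transition (Fin (size S)) d) :=
  {t | (∃ s, t = M.loopTrans s) ∨ (∃ s s', M.next s s' ∧ t = M.exitTrans s s') ∨
    (∃ s, M.Terminal s ∧ t = stopTrans d s) ∨ ∃ i, t = gatherTrans S c i}

theorem finite_transSet (c : Fin d) : (M.transSet c).Finite := by
  refine ((Set.finite_range M.loopTrans).union
    ((Set.finite_range fun p : S × S => M.exitTrans p.1 p.2).union
    ((Set.finite_range (stopTrans d)).union (Set.finite_range (gatherTrans S c))))).subset ?_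
  rintro t (⟨s, rfl⟩ | ⟨s, s', -, rfl⟩ | ⟨s, -, rfl⟩ | ⟨i, rfl⟩)
  · exact Or.inl ⟨s, rfl⟩
  · exact Or.inr (Or.inl ⟨(s, s'), rfl⟩)
  · exact Or.inr (Or.inr (Or.inl ⟨s, rfl⟩))
  · exact Or.inr (Or.inr (Or.inr ⟨i, rfl⟩))

/-- The input of the coverability problem that asks whether the drain machine halts from the state
`s₀` and the vector `u₀`: can the extra state be covered with the whole mass of `u₀` collected in
the counter `c`? -/
noncomputable def toInput (c : Fin d) (s₀ : S) (u₀ : Fin d → ℚ) : CoverInput resetMatrices where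
  n := size S
  d := d
  trans := (M.finite_transSet c).toFinset.toList
  mat_mem := by
    intro t ht
    simp only [Finset.mem_toList, Set.Finite.mem_toFinset] at ht
    rcases ht with ⟨s, rfl⟩ | ⟨s, s', -, rfl⟩ | ⟨s, -, rfl⟩ | ⟨i, rfl⟩
    · exact one_mem_resetMatrices
    · exact resetMatrix_mem_resetMatrices _
    · exact one_mem_resetMatrices
    · exact one_mem_resetMatrices
  source := Config.ofVec (num (some s₀)) u₀
  target := Config.ofVec (num none) (Pi.single c (∑ i, u₀ i))

/-- The machine of `toInput`. -/
noncomputable def vass (c : Fin d) : AffineVASS (Fin (size S)) d :=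
  ⟨M.transSet c, M.finite_transSet c⟩

theorem toInput_machine (c : Fin d) (s₀ : S) (u₀ : Fin d → ℚ) :
    (M.toInput c s₀ u₀).machine = M.vass c := by
  have : {t | t ∈ (M.toInput c s₀ u₀).trans} = M.transSet c := by
    ext t
    exact Finset.mem_toList.trans (Set.Finite.mem_toFinset _)
  simp only [CoverInput.machine, vass]
  congr 1

/-- What holds in the configurations that are reachable without any loss of mass: in the state
`s`, the vector arises from a reachable vector by a partial drain, and the extra state is reached
only if the drain machine halts. -/
def Lossless (x : S × (Fin d → ℚ)) (D : Config (Fin (size S)) d) : Prop :=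
  (∀ s, D.state = num (some s) →
    ∃ (u : Fin d → ℚ) (t : ℚ), M.Reaches x (s, u) ∧ D.vec = u + t • M.dirQ s) ∧
  (D.state = num none → M.Halts x)

/-- The sum of all counters never grows, and as long as it is preserved the configurations are those
of a run of the drain machine. -/
theorem step_lossless {c : Fin d} {x : S × (Fin d → ℚ)} {m : ℚ} {C D : Config (Fin (size S)) d}
    (h : (M.vass c).Step C D) (hC : ∑ i, C.vec i ≤ m ∧ (∑ i, C.vec i = m → M.Lossless x C)) :
    ∑ i, D.vec i ≤ m ∧ (∑ i, D.vec i = m → M.Lossless x D) := by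
  obtain ⟨hm, hl⟩ := hC
  obtain ⟨α, -, -, t, ht, h⟩ := h
  rcases ht with ⟨s, rfl⟩ | ⟨s, s', hn, rfl⟩ | ⟨s, hs, rfl⟩ | ⟨i, rfl⟩
  · obtain ⟨h1, h2, h3⟩ := stepBy_one_iff.1 h
    change D.vec = C.vec + α • M.dirQ s at h3
    have e : ∑ i, D.vec i = ∑ i, C.vec i := by rw [h3, sum_add_smul_dirQ]
    rw [e]
    refine ⟨hm, fun hm' => ⟨fun s' hs' => ?_, fun hs' => ?_⟩⟩
    · obtain rfl : s = s' := by simpa using h2.trans hs'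
      obtain ⟨u, t, hu, hut⟩ := (hl hm').1 s h1.symm
      exact ⟨u, t + α, hu, by rw [h3, hut]; module⟩
    · simp [← h2] at hs'
  · obtain ⟨h1, h2, h3⟩ := stepBy_reset_iff.1 h
    have e : ∑ i, D.vec i = ∑ i, C.vec i - C.vec (M.pivot s) := by rw [h3, sum_resetAt]
    have h0 := C.vec_nonneg (M.pivot s)
    simp only [Pi.zero_apply] at h0
    refine ⟨by linarith, fun hm' => ⟨fun s'' hs' => ?_, fun hs' => ?_⟩⟩
    · obtain rfl : s' = s'' := by simpa using h2.trans hs'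
      -- A reset at no loss of mass is a zero test.
      have hz : C.vec (M.pivot s) = 0 := by linarith
      obtain ⟨u, t, hu, hut⟩ := (hl (by linarith)).1 s h1.symm
      have hd : D.vec = M.drain s u := by
        rw [← M.add_smul_dirQ_eq_drain (hut ▸ hz), ← hut, h3]
        funext i
        by_cases hi : i = M.pivot s <;> simp [resetAt, hi, hz]
      exact ⟨D.vec, 0, hu.tail ⟨hn, hd, D.vec_nonneg⟩, by simp⟩
    · simp [← h2] at hs'
  · obtain ⟨h1, h2, h3⟩ := stepBy_one_iff.1 h
    have e : D.vec = C.vec := by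
      rw [h3]
      funext i
      simp
    rw [e]
    refine ⟨hm, fun hm' => ⟨fun s' hs' => ?_, fun hs' => ?_⟩⟩
    · simp [← h2] at hs'
    · obtain ⟨u, t, hu, -⟩ := (hl hm').1 s h1.symm
      exact ⟨_, hu, hs⟩
  · obtain ⟨h1, h2, h3⟩ := stepBy_one_iff.1 h
    have e : ∑ i, D.vec i = ∑ i, C.vec i := by
      simp [h3, Finset.sum_add_distrib, ← Finset.mul_sum, Finset.sum_sub_distrib, Pi.single_apply]
    rw [e]
    refine ⟨hm, fun hm' => ⟨fun s' hs' => ?_, fun hs' => ?_⟩⟩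
    · simp [← h2] at hs'
    · exact (hl hm').2 h1.symm

/-- Every drain is performed by the loop at its state, after which the reset of the pivot changes
nothing. -/
theorem reaches_of_reaches {c : Fin d} {x y : S × (Fin d → ℚ)} (hx : 0 ≤ x.2)
    (h : M.Reaches x y) :
    (M.vass c).Reaches (Config.ofVec (num (some x.1)) x.2) (Config.ofVec (num (some y.1)) y.2) := by
  induction h with
  | refl => exact Relation.ReflTransGen.refl
  | @tail y z hy hz ih =>
    obtain ⟨hn, hd, h0⟩ := hz
    have hy0 := Reaches.nonneg hy hx
    have hloop := AffineVASS.reaches_loop (M.vass c) (p := num (some y.1)) (b := M.dir y.1)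
      (Or.inl ⟨y.1, rfl⟩) hy0 (div_nonneg (hy0 (M.pivot y.1))
        (neg_nonneg.2 (M.dirQ_pivot_neg y.1).le)) (by rw [hd] at h0; exact h0)
    change (M.vass c).Reaches _ (Config.ofVec _ (M.drain y.1 y.2)) at hloop
    rw [← hd] at hloop
    refine (ih.trans hloop).tail ⟨1, one_pos, le_rfl, M.exitTrans y.1 z.1,
      Or.inr (Or.inl ⟨y.1, z.1, hn, rfl⟩), stepBy_reset_iff.2 ⟨rfl, rfl, ?_⟩⟩
    rw [Config.vec_ofVec _ h0, Config.vec_ofVec _ h0]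
    funext i
    by_cases hi : i = M.pivot y.1
    · simp [resetAt, hi, hd, drain_pivot]
    · simp [resetAt, hi]

theorem reaches_gather (c : Fin d) (u : Fin d → ℚ) (hu : 0 ≤ u) :
    (M.vass c).Reaches (Config.ofVec (num none) u)
      (Config.ofVec (num none) (Pi.single c (∑ i, u i))) := by
  -- The counters of a set `A` are emptied one after the other.
  suffices H : ∀ A : Finset (Fin d), c ∉ A → (M.vass c).Reaches (Config.ofVec (num none) u)
      (Config.ofVec (num none)
        (fun i => if i = c then u c + ∑ j ∈ A, u j else if i ∈ A then 0 else u i)) by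
    convert H (Finset.univ.erase c) (by simp) using 2
    funext i
    rw [Finset.add_sum_erase _ _ (Finset.mem_univ c)]
    by_cases hi : i = c <;> simp [hi]
  intro A
  induction A using Finset.induction_on with
  | empty =>
    intro _
    have e : (fun i => if i = c then u c + ∑ j ∈ (∅ : Finset (Fin d)), u j
        else if i ∈ (∅ : Finset (Fin d)) then 0 else u i) = u := by
      funext i
      by_cases hi : i = c <;> simp [hi]
    rw [e]
    exact Relation.ReflTransGen.refl
  | insert a A ha ih =>
    intro hc
    simp only [Finset.mem_insert, not_or] at hc
    refine (ih hc.2).trans ?_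
    set w : Fin d → ℚ := fun i => if i = c then u c + ∑ j ∈ A, u j else if i ∈ A then 0 else u i
      with hw
    have hw0 : 0 ≤ w := fun i => by
      simp only [hw, Pi.zero_apply]
      split_ifs
      · exact add_nonneg (hu c) (Finset.sum_nonneg fun j _ => hu j)
      · exact le_rfl
      · exact hu i
    have hac : a ≠ c := Ne.symm hc.1
    have e : w + u a • (fun i => (((Pi.single c 1 - Pi.single a 1 : Fin d → ℤ) i : ℤ) : ℚ)) =
        fun i => if i = c then u c + ∑ j ∈ insert a A, u j
          else if i ∈ insert a A then 0 else u i := by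
      funext i
      by_cases hi : i = c
      · subst hi
        simp [hw, Finset.sum_insert ha, hc.1, Pi.single_apply]
        ring
      · by_cases hi' : i = a
        · subst hi'
          simp [hw, hi, ha, Pi.single_apply]
        · simp [hw, hi, hi', Pi.single_apply]
    have hloop := AffineVASS.reaches_loop (M.vass c) (p := num none)
      (b := Pi.single c 1 - Pi.single a 1) (Or.inr (Or.inr (Or.inr ⟨a, rfl⟩))) hw0 (hu a)
    rw [e] at hloop
    refine hloop fun i => ?_
    simp only [Pi.zero_apply]
    split_ifs
    · exact add_nonneg (hu c) (Finset.sum_nonneg fun j _ => hu j)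
    · exact le_rfl
    · exact hu i

/-- Covering the whole mass means that no reset ever lost anything, so that all the resets were
zero tests and the VASS faithfully simulated the drain machine. -/
theorem toInput_holds_iff (c : Fin d) (s₀ : S) {u₀ : Fin d → ℚ} (hu₀ : 0 ≤ u₀) :
    (M.toInput c s₀ u₀).Holds ↔ M.Halts (s₀, u₀) := by
  rw [CoverInput.Holds, toInput_machine]
  have hsum : 0 ≤ ∑ i, u₀ i := Finset.sum_nonneg fun i _ => hu₀ i
  have hsingle : (0 : Fin d → ℚ) ≤ Pi.single c (∑ i, u₀ i) := Pi.single_nonneg.2 hsum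
  constructor
  · rintro ⟨D, hD, hs, hle⟩
    have inv : ∑ i, D.vec i ≤ ∑ i, u₀ i ∧
        (∑ i, D.vec i = ∑ i, u₀ i → M.Lossless (s₀, u₀) D) := by
      clear hs hle
      induction hD with
      | refl =>
        have e : (M.toInput c s₀ u₀).source.vec = u₀ := Config.vec_ofVec _ hu₀
        rw [e]
        refine ⟨le_rfl, fun _ => ⟨fun s hs => ?_, fun hs => ?_⟩⟩
        · obtain rfl : s₀ = s := by simpa [toInput] using hs
          exact ⟨u₀, 0, Relation.ReflTransGen.refl, by rw [zero_smul, add_zero]; exact e⟩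
        · simp [toInput] at hs
      | tail _ h ih => exact M.step_lossless h ih
    refine (inv.2 (le_antisymm inv.1 ?_)).2 hs
    have h1 : ∑ i, u₀ i ≤ D.vec c := by
      have h2 : (M.toInput c s₀ u₀).target.vec c ≤ D.vec c := NNRat.coe_le_coe.2 (hle c)
      have e : (M.toInput c s₀ u₀).target.vec = Pi.single c (∑ i, u₀ i) :=
        Config.vec_ofVec _ hsingle
      rwa [e, Pi.single_eq_same] at h2
    exact h1.trans (Finset.single_le_sum (fun i _ => D.vec_nonneg i) (Finset.mem_univ c))
  · rintro ⟨⟨s, u⟩, hr, hs⟩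
    have hu : 0 ≤ u := Reaches.nonneg hr hu₀
    refine ⟨Config.ofVec (num none) (Pi.single c (∑ i, u i)), ?_, rfl, fun i => ?_⟩
    · refine ((M.reaches_of_reaches hu₀ hr).tail ⟨1, one_pos, le_rfl, stopTrans d s,
        Or.inr (Or.inr (Or.inl ⟨s, hs, rfl⟩)), stepBy_one_iff.2 ⟨rfl, rfl, ?_⟩⟩).trans
        (M.reaches_gather c u hu)
      rw [Config.vec_ofVec _ hu, Config.vec_ofVec _ hu]
      funext i
      simp
    · rw [show ∑ i, u i = ∑ i, u₀ i from Reaches.sum_eq hr]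
      exact le_rfl

end DrainMachine

open Turing

/-! ### Stacks as rational numbers -/

/-- A numbering of an alphabet by numbers below `m` in which the blank has the number `0`. -/
structure SymbolCode (Γ : Type) [Inhabited Γ] where
  m : ℕ
  code : Γ → ℕ
  code_lt : ∀ a, code a < m
  code_injective : Function.Injective code
  code_default : code default = 0

namespace SymbolCode

variable {Γ : Type} [Inhabited Γ]

theorem nonempty_of_finite [Finite Γ] : Nonempty (SymbolCode Γ) := by
  classical
  obtain ⟨m, ⟨e⟩⟩ := Finite.exists_equiv_fin Γ
  have hm : 0 < m := (Nat.zero_le _).trans_lt (e default).2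
  exact ⟨⟨m, fun a => Equiv.swap (e default) ⟨0, hm⟩ (e a), fun a => Fin.is_lt _,
    fun a b h => by simpa [Fin.ext_iff.symm] using h, by simp⟩⟩

variable (σ : SymbolCode Γ)

/-- The base of the expansions that represent stacks. It is twice the number of symbols, and the
digits are even: thus the first digit of an expansion is determined by non-strict inequalities. -/
def base : ℕ := 2 * σ.m

theorem base_pos : (0 : ℚ) < σ.base := by
  have : 0 < σ.m := (Nat.zero_le _).trans_lt (σ.code_lt default)
  simp only [base]
  positivity

/-- The value of a list of symbols as the expansion with the digits `2 * code a`. -/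
def listValue (l : List Γ) : ℚ := l.foldr (fun a x => (2 * σ.code a + x) / σ.base) 0

theorem listValue_append_blanks (l : List Γ) (n : ℕ) :
    σ.listValue (l ++ List.replicate n default) = σ.listValue l := by
  have : σ.listValue (List.replicate n default) = 0 := by
    induction n with
    | zero => rfl
    | succ n ih =>
      rw [List.replicate_succ]
      change (2 * (σ.code default : ℚ) + σ.listValue (List.replicate n default)) / σ.base = 0
      simp [ih, σ.code_default]
  simp only [listValue, List.foldr_append] at this ⊢
  rw [this]

/-- The value of a stack, which does not depend on the number of blanks at its bottom. -/
def value (l : ListBlank Γ) : ℚ :=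
  l.liftOn σ.listValue fun a b ⟨n, h⟩ => by rw [h, listValue_append_blanks]

theorem value_mk (l : List Γ) : σ.value (ListBlank.mk l) = σ.listValue l := rfl

theorem value_cons (a : Γ) (l : ListBlank Γ) :
    σ.value (l.cons a) = (2 * σ.code a + σ.value l) / σ.base := by
  induction l using ListBlank.induction_on with
  | h l => rw [ListBlank.cons_mk, value_mk, value_mk]; rfl

theorem value_mem (l : ListBlank Γ) : 0 ≤ σ.value l ∧ σ.value l ≤ 1 := by
  induction l using ListBlank.induction_on with
  | h l =>
    rw [value_mk]
    induction l with
    | nil => simp [listValue]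
    | cons a l ih =>
      change 0 ≤ (2 * (σ.code a : ℚ) + σ.listValue l) / σ.base ∧
        (2 * (σ.code a : ℚ) + σ.listValue l) / σ.base ≤ 1
      have h1 : (σ.code a : ℚ) + 1 ≤ σ.m := by exact_mod_cast σ.code_lt a
      rw [div_le_one σ.base_pos]
      refine ⟨div_nonneg (by linarith [ih.1, Nat.cast_nonneg (α := ℚ) (σ.code a)])
        σ.base_pos.le, ?_⟩
      simp only [base, Nat.cast_mul, Nat.cast_ofNat]
      linarith

theorem base_mul_value (l : ListBlank Γ) :
    σ.base * σ.value l = 2 * σ.code l.head + σ.value l.tail := by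
  conv_lhs => rw [← ListBlank.cons_head_tail l, value_cons]
  rw [mul_div_cancel₀ _ σ.base_pos.ne']

/-- The remainder of a popped expansion lies in the unit interval only for the right digit. -/
theorem eq_head_of_mem {l : ListBlank Γ} {a : Γ} (h0 : 0 ≤ σ.base * σ.value l - 2 * σ.code a)
    (h1 : 0 ≤ 1 - (σ.base * σ.value l - 2 * σ.code a)) : a = l.head := by
  rw [base_mul_value] at h0 h1
  obtain ⟨h2, h3⟩ := σ.value_mem l.tail
  apply σ.code_injective
  have h4 : (2 * σ.code a : ℚ) ≤ 2 * σ.code l.head + 1 := by linarith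
  have h5 : (2 * σ.code l.head : ℚ) ≤ 2 * σ.code a + 1 := by linarith
  norm_cast at h4 h5
  omega

end SymbolCode

/-! ### Turing machines as drain machines -/

/-- The side of the tape that the head moves away from. -/
def behind {Γ : Type} [Inhabited Γ] : Dir → Tape Γ → ListBlank Γ
  | Dir.left, T => T.right
  | Dir.right, T => T.left

/-- The side of the tape that the head moves towards. -/
def ahead {Γ : Type} [Inhabited Γ] : Dir → Tape Γ → ListBlank Γ
  | Dir.left, T => T.left
  | Dir.right, T => T.right

theorem behind_move {Γ : Type} [Inhabited Γ] (δ : Dir) (T : Tape Γ) :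
    behind δ (T.move δ) = (behind δ T).cons T.head := by
  cases δ <;> rfl

theorem ahead_move {Γ : Type} [Inhabited Γ] (δ : Dir) (T : Tape Γ) :
    ahead δ (T.move δ) = (ahead δ T).tail := by
  cases δ <;> rfl

theorem head_move {Γ : Type} [Inhabited Γ] (δ : Dir) (T : Tape Γ) :
    (T.move δ).head = (ahead δ T).head := by
  cases δ <;> rfl

/-- The vector of the six counters: the left stack and its complement, the right stack and its
complement, a temporary counter and the unit. For a move `δ` of the head, `x`, `x'` belong to the
stack behind the head, `y`, `y'` to the stack ahead of it. -/
def arrange {R : Type} : Dir → R → R → R → R → R → R → Fin 6 → R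
  | Dir.left, x, x', y, y', t, e => ![y, y', x, x', t, e]
  | Dir.right, x, x', y, y', t, e => ![x, x', y, y', t, e]

theorem arrange_nonneg {δ : Dir} {x x' y y' t e : ℚ} :
    0 ≤ arrange δ x x' y y' t e ↔ 0 ≤ x ∧ 0 ≤ x' ∧ 0 ≤ y ∧ 0 ≤ y' ∧ 0 ≤ t ∧ 0 ≤ e := by
  cases δ 
  · simp only [arrange, Pi.le_def, Fin.forall_fin_succ]
    simp
    tauto
  · simp [arrange, Pi.le_def, Fin.forall_fin_succ]

theorem sum_arrange {R : Type} [CommRing R] {δ : Dir} {x x' y y' t e : R} :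
    ∑ i, arrange δ x x' y y' t e i = x + x' + y + y' + t + e := by
  cases δ <;> simp [arrange, Fin.sum_univ_succ] <;> ring

theorem add_smul_arrange {δ : Dir} {x x' y y' t e x₁ x₁' y₁ y₁' t₁ e₁ r : ℚ} :
    arrange δ x x' y y' t e + r • arrange δ x₁ x₁' y₁ y₁' t₁ e₁ =
      arrange δ (x + r * x₁) (x' + r * x₁') (y + r * y₁) (y' + r * y₁') (t + r * t₁)
        (e + r * e₁) := by
  cases δ <;> simp [arrange]

theorem cast_arrange {δ : Dir} {x x' y y' t e : ℤ} :
    (fun i => (((arrange δ x x' y y' t e : Fin 6 → ℤ) i : ℤ) : ℚ)) =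
      arrange δ (x : ℚ) (x' : ℚ) (y : ℚ) (y' : ℚ) (t : ℚ) (e : ℚ) := by
  funext i
  cases δ <;> fin_cases i <;> rfl

/-- The six drains that simulate a move of the head which pushes `a` behind the head and pops `b`
ahead of it: `shrink` and `restore` divide the stack behind the head by the base, `exchange` and
`refund` add the digit of `a` to it and subtract the digit of `b` from the other stack, `expand` and
`deliver` multiply the other stack by the base. -/
inductive Phase
  | shrink | restore | exchange | refund | expand | deliver

/-- The control states of the simulation: `main q a` represents the state `q` of the Turing machine
with the symbol `a` under the head; in `move p q δ a b` a move in direction `δ` is in progress, from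
the symbol `a` to the guessed symbol `b`, with new state `q`. -/
inductive SimState (Γ Λ : Type)
  | main (q : Λ) (a : Γ)
  | move (p : Phase) (q : Λ) (δ : Dir) (a b : Γ)

instance : Finite Phase :=
  Finite.of_surjective (fun i : Fin 6 => ![Phase.shrink, .restore, .exchange, .refund, .expand,
    .deliver] i) fun p => by
      cases p
      exacts [⟨0, rfl⟩, ⟨1, rfl⟩, ⟨2, rfl⟩, ⟨3, rfl⟩, ⟨4, rfl⟩, ⟨5, rfl⟩]

instance : Finite Dir :=
  Finite.of_surjective (fun b : Bool => if b then Dir.left else Dir.right) fun δ => by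
    cases δ
    exacts [⟨true, rfl⟩, ⟨false, rfl⟩]

instance {Γ Λ : Type} [Finite Γ] [Finite Λ] : Finite (SimState Γ Λ) :=
  Finite.of_surjective
    (Sum.elim (fun x : Λ × Γ => SimState.main x.1 x.2)
      (fun x : Phase × Λ × Dir × Γ × Γ =>
        SimState.move x.1 x.2.1 x.2.2.1 x.2.2.2.1 x.2.2.2.2)) fun s => by
    cases s with
    | main q a => exact ⟨Sum.inl (q, a), rfl⟩
    | move p q δ a b => exact ⟨Sum.inr (p, q, δ, a, b), rfl⟩

section Simulation

variable {Γ Λ : Type} [Inhabited Γ] [Inhabited Λ]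

/-- The counter that is drained in each phase. -/
def Phase.pivot (δ : Dir) : Phase → Fin 6
  | shrink => match δ with
    | Dir.left => 2
    | Dir.right => 0
  | exchange => 5
  | expand => match δ with
    | Dir.left => 0
    | Dir.right => 2
  | restore | refund | deliver => 4

/-- The direction of the drain in each phase, with base `B` and digits `a`, `b`. -/
def Phase.dir (B a b : ℤ) (δ : Dir) : Phase → Fin 6 → ℤ
  | shrink => arrange δ (-B) (B - 1) 0 0 1 0
  | restore => arrange δ 1 0 0 0 (-1) 0
  | exchange => arrange δ a (-a) (-b) b B (-B)
  | refund => arrange δ 0 0 0 0 (-1) 1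
  | expand => arrange δ 0 0 (-1) (-(B - 1)) B 0
  | deliver => arrange δ 0 0 1 0 (-1) 0

/-- The control flow of the simulation. The symbol that is popped is guessed at the beginning of a
move; a wrong guess makes a later drain impossible. -/
inductive SimNext (M : TM0.Machine Γ Λ) : SimState Γ Λ → SimState Γ Λ → Prop
  | write {q a q' b} (h : (q', TM0.Stmt.write b) ∈ M q a) : SimNext M (.main q a) (.main q' b)
  | start {q a q' δ} (b) (h : (q', TM0.Stmt.move δ) ∈ M q a) :
      SimNext M (.main q a) (.move .shrink q' δ a b)
  | shrink {q δ a b} : SimNext M (.move .shrink q δ a b) (.move .restore q δ a b)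
  | restore {q δ a b} : SimNext M (.move .restore q δ a b) (.move .exchange q δ a b)
  | exchange {q δ a b} : SimNext M (.move .exchange q δ a b) (.move .refund q δ a b)
  | refund {q δ a b} : SimNext M (.move .refund q δ a b) (.move .expand q δ a b)
  | expand {q δ a b} : SimNext M (.move .expand q δ a b) (.move .deliver q δ a b)
  | deliver {q δ a b} : SimNext M (.move .deliver q δ a b) (.main q b)

/-- The drain machine that simulates a Turing machine, with the even digits `2 * σ.code a`. The drain
in the main states has no effect, as the temporary counter is empty there. -/
def simulation (σ : SymbolCode Γ) (M : TM0.Machine Γ Λ) : DrainMachine (SimState Γ Λ) 6 where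
  pivot
    | .main _ _ => 4
    | .move p _ δ _ _ => p.pivot δ
  dir
    | .main _ _ => Phase.dir σ.base 0 0 Dir.left .refund
    | .move p _ δ a b => p.dir σ.base (2 * σ.code a) (2 * σ.code b) δ
  next := SimNext M
  dir_pivot_neg s := by
    have hB : 0 < σ.base := by exact_mod_cast σ.base_pos
    rcases s with _ | ⟨p, q, δ, a, b⟩
    · simp [Phase.dir, arrange]
    · cases p <;> cases δ <;> simp [Phase.dir, arrange, Phase.pivot, hB]
  sum_dir s := by
    rcases s with _ | ⟨p, q, δ, a, b⟩
    · simp [Phase.dir, sum_arrange]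
    · cases p <;> simp only [Phase.dir, sum_arrange] <;> ring

variable (σ : SymbolCode Γ) (M : TM0.Machine Γ Λ)

/-- The counter values that represent a tape. -/
def tapeVec (T : Tape Γ) : Fin 6 → ℚ :=
  arrange Dir.right (σ.value T.left) (1 - σ.value T.left) (σ.value T.right) (1 - σ.value T.right)
    0 1

theorem tapeVec_eq_arrange (δ : Dir) (T : Tape Γ) : tapeVec σ T =
    arrange δ (σ.value (behind δ T)) (1 - σ.value (behind δ T)) (σ.value (ahead δ T))
      (1 - σ.value (ahead δ T)) 0 1 := by
  cases δ <;> rfl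

/-- The counter values at the beginning of each phase, where `x` and `y` are the initial values of
the stack behind the head and of the stack ahead of it, and `a` and `b` are the digits. -/
def stage (B x y a b : ℚ) (δ : Dir) : Phase → Fin 6 → ℚ
  | .shrink => arrange δ x (1 - x) y (1 - y) 0 1
  | .restore => arrange δ 0 (1 - x / B) y (1 - y) (x / B) 1
  | .exchange => arrange δ (x / B) (1 - x / B) y (1 - y) 0 1
  | .refund => arrange δ ((a + x) / B) (1 - (a + x) / B) (y - b / B) (1 - (y - b / B)) 1 0
  | .expand => arrange δ ((a + x) / B) (1 - (a + x) / B) (y - b / B) (1 - (y - b / B)) 0 1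
  | .deliver => arrange δ ((a + x) / B) (1 - (a + x) / B) 0 (1 - (B * y - b)) (B * y - b) 1

/-- The counter values after the last phase. -/
def lastStage (B x y a b : ℚ) (δ : Dir) : Fin 6 → ℚ :=
  arrange δ ((a + x) / B) (1 - (a + x) / B) (B * y - b) (1 - (B * y - b)) 0 1

/-- To compute a drain it suffices to exhibit the multiple of the direction that is added. -/
theorem drain_eq_of {S : Type} {N : DrainMachine S 6} {s : S} {u v : Fin 6 → ℚ} (r : ℚ)
    (h : u + r • N.dirQ s = v) (hv : v (N.pivot s) = 0) : N.drain s u = v := by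
  rw [← h] at hv ⊢
  exact (N.add_smul_dirQ_eq_drain hv).symm

theorem drain_main (q : Λ) (a : Γ) (T : Tape Γ) :
    (simulation σ M).drain (.main q a) (tapeVec σ T) = tapeVec σ T :=
  drain_eq_of 0 (by simp) rfl

variable {σ M}

section

variable {q : Λ} {δ : Dir} {a b : Γ} {x y : ℚ}

theorem dirQ_move (p : Phase) :
    (simulation σ M).dirQ (.move p q δ a b) =
      fun i => (p.dir σ.base (2 * σ.code a) (2 * σ.code b) δ i : ℚ) := rfl

theorem drain_shrink : (simulation σ M).drain (.move .shrink q δ a b)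
    (stage σ.base x y (2 * σ.code a) (2 * σ.code b) δ .shrink) =
      stage σ.base x y (2 * σ.code a) (2 * σ.code b) δ .restore := by
  have hB := σ.base_pos.ne'
  refine drain_eq_of (x / σ.base) ?_ (by cases δ <;> rfl)
  simp only [dirQ_move, Phase.dir, stage]
  rw [cast_arrange, add_smul_arrange]
  push_cast
  congr 1 <;> field_simp <;> ring

theorem drain_restore : (simulation σ M).drain (.move .restore q δ a b)
    (stage σ.base x y (2 * σ.code a) (2 * σ.code b) δ .restore) =
      stage σ.base x y (2 * σ.code a) (2 * σ.code b) δ .exchange := by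
  refine drain_eq_of (x / σ.base) ?_ (by cases δ <;> rfl)
  simp only [dirQ_move, Phase.dir, stage]
  rw [cast_arrange, add_smul_arrange]
  push_cast
  congr 1 <;> ring

theorem drain_exchange : (simulation σ M).drain (.move .exchange q δ a b)
    (stage σ.base x y (2 * σ.code a) (2 * σ.code b) δ .exchange) =
      stage σ.base x y (2 * σ.code a) (2 * σ.code b) δ .refund := by
  have hB := σ.base_pos.ne'
  refine drain_eq_of (1 / σ.base) ?_ (by cases δ <;> rfl)
  simp only [dirQ_move, Phase.dir, stage]
  rw [cast_arrange, add_smul_arrange]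
  push_cast
  congr 1 <;> field_simp <;> ring

theorem drain_refund : (simulation σ M).drain (.move .refund q δ a b)
    (stage σ.base x y (2 * σ.code a) (2 * σ.code b) δ .refund) =
      stage σ.base x y (2 * σ.code a) (2 * σ.code b) δ .expand := by
  refine drain_eq_of 1 ?_ (by cases δ <;> rfl)
  simp only [dirQ_move, Phase.dir, stage]
  rw [cast_arrange, add_smul_arrange]
  push_cast
  congr 1 <;> ring

theorem drain_expand : (simulation σ M).drain (.move .expand q δ a b)
    (stage σ.base x y (2 * σ.code a) (2 * σ.code b) δ .expand) =
      stage σ.base x y (2 * σ.code a) (2 * σ.code b) δ .deliver := by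
  have hB := σ.base_pos.ne'
  refine drain_eq_of (y - 2 * σ.code b / σ.base) ?_ (by cases δ <;> rfl)
  simp only [dirQ_move, Phase.dir, stage]
  rw [cast_arrange, add_smul_arrange]
  push_cast
  congr 1 <;> field_simp <;> ring

theorem drain_deliver : (simulation σ M).drain (.move .deliver q δ a b)
    (stage σ.base x y (2 * σ.code a) (2 * σ.code b) δ .deliver) =
      lastStage σ.base x y (2 * σ.code a) (2 * σ.code b) δ := by
  refine drain_eq_of (σ.base * y - 2 * σ.code b) ?_ (by cases δ <;> rfl)
  simp only [dirQ_move, Phase.dir, stage, lastStage]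
  rw [cast_arrange, add_smul_arrange]
  push_cast
  congr 1 <;> ring

end

theorem stage_shrink (δ : Dir) (T : Tape Γ) (a b : ℚ) :
    stage σ.base (σ.value (behind δ T)) (σ.value (ahead δ T)) a b δ .shrink = tapeVec σ T :=
  (tapeVec_eq_arrange σ δ T).symm

theorem lastStage_eq_tapeVec (δ : Dir) (T : Tape Γ) :
    lastStage σ.base (σ.value (behind δ T)) (σ.value (ahead δ T)) (2 * σ.code T.head)
      (2 * σ.code (ahead δ T).head) δ = tapeVec σ (T.move δ) := by
  rw [tapeVec_eq_arrange σ δ, behind_move, ahead_move, lastStage, σ.value_cons,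
    σ.base_mul_value]
  congr 1 <;> ring

theorem tapeVec_nonneg (T : Tape Γ) : 0 ≤ tapeVec σ T := by
  obtain ⟨h1, h2⟩ := σ.value_mem T.left
  obtain ⟨h3, h4⟩ := σ.value_mem T.right
  rw [tapeVec, arrange_nonneg]
  exact ⟨h1, by linarith, h3, by linarith, le_rfl, one_pos.le⟩

/-- With the right guess of the popped symbol, all the phases of a move are possible. -/
theorem stage_nonneg (δ : Dir) (T : Tape Γ) (p : Phase) :
    0 ≤ stage σ.base (σ.value (behind δ T)) (σ.value (ahead δ T)) (2 * σ.code T.head)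
      (2 * σ.code (ahead δ T).head) δ p := by
  have hB := σ.base_pos
  have hB1 : (1 : ℚ) ≤ σ.base := by exact_mod_cast hB
  obtain ⟨hx0, hx1⟩ := σ.value_mem (behind δ T)
  obtain ⟨hy0, hy1⟩ := σ.value_mem (ahead δ T)
  obtain ⟨hx0', hx1'⟩ := σ.value_mem ((behind δ T).cons T.head)
  rw [σ.value_cons] at hx0' hx1'
  obtain ⟨hy0', hy1'⟩ := σ.value_mem (ahead δ T).tail
  -- As the right symbol is popped, the remainder of the stack ahead is again the value of a stack.
  have hy := σ.base_mul_value (ahead δ T)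
  generalize σ.value (behind δ T) = x at *
  have hx2 : 0 ≤ x / σ.base := div_nonneg hx0 hB.le
  have hx3 : x / σ.base ≤ 1 := (div_le_one hB).2 (hx1.trans hB1)
  have hy2 : σ.value (ahead δ T) - 2 * σ.code (ahead δ T).head / σ.base =
      σ.value (ahead δ T).tail / σ.base := by
    field_simp
    linarith
  have hy3 : 0 ≤ σ.value (ahead δ T).tail / σ.base := div_nonneg hy0' hB.le
  have hy4 : σ.value (ahead δ T).tail / σ.base ≤ 1 := (div_le_one hB).2 (hy1'.trans hB1)
  cases p <;> simp only [stage, arrange_nonneg, hy2, hy] <;>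
    refine ⟨?_, ?_, ?_, ?_, ?_, ?_⟩ <;> linarith

/-- A drain machine run that simulates one step of the Turing machine. -/
theorem simulation_reaches_step {c c' : TM0.Cfg Γ Λ} (h : c' ∈ TM0.step M c) :
    (simulation σ M).Reaches (.main c.q c.Tape.head, tapeVec σ c.Tape)
      (.main c'.q c'.Tape.head, tapeVec σ c'.Tape) := by
  obtain ⟨q, T⟩ := c
  obtain ⟨⟨q', s⟩, hM, rfl⟩ := Option.map_eq_some_iff.1 h
  cases s with
  | write b =>
    exact Relation.ReflTransGen.single
      ⟨SimNext.write hM, (drain_main σ M q T.head T).symm, tapeVec_nonneg _⟩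
  | move δ =>
    have step : ∀ {s s' : SimState Γ Λ} {u v : Fin 6 → ℚ}, SimNext M s s' →
        (simulation σ M).drain s u = v → 0 ≤ v → (simulation σ M).Reaches (s, u) (s', v) :=
      fun h1 h2 h3 => Relation.ReflTransGen.single ⟨h1, h2.symm, h3⟩
    have hs := stage_nonneg (σ := σ) δ T
    have h0 := step (SimNext.start (ahead δ T).head hM)
      (drain_main σ M q T.head T) (tapeVec_nonneg T)
    conv at h0 =>
      rhs
      rw [← stage_shrink δ T (2 * σ.code T.head) (2 * σ.code (ahead δ T).head)]
    have h1 := h0.trans (step SimNext.shrink drain_shrink (hs _))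
    have h2 := h1.trans (step SimNext.restore drain_restore (hs _))
    have h3 := h2.trans (step SimNext.exchange drain_exchange (hs _))
    have h4 := h3.trans (step SimNext.refund drain_refund (hs _))
    have h5 := h4.trans (step SimNext.expand drain_expand (hs _))
    have h6 := h5.trans (step SimNext.deliver drain_deliver
      (by rw [lastStage_eq_tapeVec]; exact tapeVec_nonneg _))
    rw [lastStage_eq_tapeVec, ← head_move] at h6
    exact h6

/-- What holds in the configurations that are reachable in the simulation of a run from `c₀`. -/
def SimInv (σ : SymbolCode Γ) (M : TM0.Machine Γ Λ) (c₀ : TM0.Cfg Γ Λ) :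
    SimState Γ Λ × (Fin 6 → ℚ) → Prop
  | (.main q a, u) => ∃ T : Tape Γ, TM0.Reaches M c₀ ⟨q, T⟩ ∧ T.head = a ∧ u = tapeVec σ T
  | (.move p q δ a b, u) => ∃ (q₀ : Λ) (T : Tape Γ), TM0.Reaches M c₀ ⟨q₀, T⟩ ∧ T.head = a ∧
      (q, TM0.Stmt.move δ) ∈ M q₀ a ∧
      u = stage σ.base (σ.value (behind δ T)) (σ.value (ahead δ T)) (2 * σ.code a)
        (2 * σ.code b) δ p

theorem simInv_step {c₀ : TM0.Cfg Γ Λ} {x y : SimState Γ Λ × (Fin 6 → ℚ)}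
    (hx : SimInv σ M c₀ x) (h : (simulation σ M).Step x y) : SimInv σ M c₀ y := by
  obtain ⟨s, u⟩ := x
  obtain ⟨s', v⟩ := y
  obtain ⟨hn, hv, h0⟩ := h
  change SimNext M s s' at hn
  dsimp only at hv h0
  subst hv
  cases hn with
  | write hM =>
    obtain ⟨T, hT, rfl, rfl⟩ := hx
    exact ⟨T.write _, hT.tail (Option.map_eq_some_iff.2 ⟨_, hM, rfl⟩), rfl, drain_main _ _ _ _ _⟩
  | start b hM =>
    obtain ⟨T, hT, rfl, rfl⟩ := hx
    exact ⟨_, T, hT, rfl, hM, by rw [drain_main, stage_shrink]⟩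
  | shrink =>
    obtain ⟨q₀, T, hT, hh, hM, rfl⟩ := hx
    exact ⟨q₀, T, hT, hh, hM, drain_shrink⟩
  | restore =>
    obtain ⟨q₀, T, hT, hh, hM, rfl⟩ := hx
    exact ⟨q₀, T, hT, hh, hM, drain_restore⟩
  | exchange =>
    obtain ⟨q₀, T, hT, hh, hM, rfl⟩ := hx
    exact ⟨q₀, T, hT, hh, hM, drain_exchange⟩
  | refund =>
    obtain ⟨q₀, T, hT, hh, hM, rfl⟩ := hx
    exact ⟨q₀, T, hT, hh, hM, drain_refund⟩
  | expand =>
    obtain ⟨q₀, T, hT, hh, hM, rfl⟩ := hx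
    exact ⟨q₀, T, hT, hh, hM, drain_expand⟩
  | @deliver q δ a b =>
    obtain ⟨q₀, T, hT, rfl, hM, rfl⟩ := hx
    rw [drain_deliver] at h0 ⊢
    -- The last drain succeeds only if the guessed symbol `b` is the one that was on the stack.
    obtain ⟨-, -, h1, h2, -⟩ := arrange_nonneg.1 h0
    obtain rfl := σ.eq_head_of_mem h1 h2
    exact ⟨T.move δ, hT.tail (Option.map_eq_some_iff.2 ⟨_, hM, rfl⟩), head_move δ T,
      lastStage_eq_tapeVec δ T⟩

theorem terminal_main_iff {q : Λ} {a : Γ} :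
    (simulation σ M).Terminal (.main q a) ↔ M q a = none := by
  constructor
  · intro h
    rcases hM : M q a with _ | ⟨q', δ | b⟩
    · rfl
    · exact absurd (SimNext.start default hM) (h _)
    · exact absurd (SimNext.write hM) (h _)
  · rintro h s' (hM | ⟨_, hM⟩) <;> simp [h] at hM

theorem not_terminal_move {p : Phase} {q : Λ} {δ : Dir} {a b : Γ} :
    ¬ (simulation σ M).Terminal (.move p q δ a b) := fun h => by
  cases p
  exacts [h _ SimNext.shrink, h _ SimNext.restore, h _ SimNext.exchange, h _ SimNext.refund,
    h _ SimNext.expand, h _ SimNext.deliver]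

theorem simulation_halts_iff (c₀ : TM0.Cfg Γ Λ) :
    (simulation σ M).Halts (.main c₀.q c₀.Tape.head, tapeVec σ c₀.Tape) ↔
      (StateTransition.eval (TM0.step M) c₀).Dom := by
  have hdom : (StateTransition.eval (TM0.step M) c₀).Dom ↔
      ∃ c, TM0.Reaches M c₀ c ∧ TM0.step M c = none := by
    rw [Part.dom_iff_mem]
    exact exists_congr fun c => StateTransition.mem_eval
  rw [hdom]
  constructor
  · rintro ⟨⟨s, u⟩, hr, ht⟩
    have inv : SimInv σ M c₀ (s, u) := by
      clear ht
      generalize (s, u) = y at hr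
      induction hr with
      | refl => exact ⟨c₀.Tape, Relation.ReflTransGen.refl, rfl, rfl⟩
      | tail _ h ih => exact simInv_step ih h
    cases s with
    | main q a =>
      obtain ⟨T, hT, rfl, -⟩ := inv
      exact ⟨_, hT, by simp [TM0.step, terminal_main_iff.1 ht]⟩
    | move p q δ a b => exact absurd ht not_terminal_move
  · rintro ⟨c, hr, hc⟩
    refine ⟨(.main c.q c.Tape.head, tapeVec σ c.Tape), ?_, terminal_main_iff.2 ?_⟩
    · clear hc
      induction hr with
      | refl => exact Relation.ReflTransGen.refl
      | tail _ h ih => exact ih.trans (simulation_reaches_step h)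
    · exact Option.map_eq_none_iff.1 hc

end Simulation

/-! ### A universal Turing machine -/

theorem primrec_pow (B : ℕ) : Primrec fun k : ℕ => B ^ k :=
  Primrec₂.comp (f := fun a b : ℕ => a ^ b) (Primrec₂.unpaired'.1 Nat.Primrec.pow)
    (Primrec.const B) Primrec.id

/-- The exponent `k` of a number `2 ^ k - 1`. -/
def exponent (m : ℕ) : ℕ := Nat.findGreatest (fun j => 2 ^ j ≤ m + 1) m

theorem exponent_two_pow_sub_one (k : ℕ) : exponent (2 ^ k - 1) = k := by
  have h := Nat.one_le_two_pow (n := k)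
  have h' := Nat.lt_two_pow_self (n := k)
  refine Nat.findGreatest_eq_iff.2 ⟨by omega, fun _ => by omega, fun n hn _ h2 => ?_⟩
  have := Nat.pow_lt_pow_right (a := 2) one_lt_two hn
  omega

theorem primrec_exponent : Primrec exponent :=
  Primrec.nat_findGreatest Primrec.id (Primrec.nat_le.comp₂
    ((primrec_pow 2).comp₂ Primrec₂.right) (Primrec.succ.comp₂ Primrec₂.left))

theorem trNat_two_pow_sub_one (k : ℕ) :
    PartrecToTM2.trNat (2 ^ k - 1) = List.replicate k PartrecToTM2.Γ'.bit1 := by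
  induction k with
  | zero => simp
  | succ k ih =>
    have h := Nat.one_le_two_pow (n := k)
    have e : 2 ^ (k + 1) - 1 = 2 * (2 ^ k - 1) + 1 := by
      rw [pow_succ]
      omega
    rw [List.replicate_succ, ← ih, e, PartrecToTM2.trNat, PartrecToTM2.trNat]
    generalize 2 ^ k - 1 = n
    have : ((2 * n + 1 : ℕ) : Num) = (n : Num).bit1 := by
      rw [← Num.bit1_of_bit1, two_mul]
      push_cast
      rfl
    rw [this]
    cases (n : Num) <;> rfl

/-- A universal program, which expects the description `k` of a partial recursive function in the
form `2 ^ k - 1`. The binary digits of such an input are all equal, so that its tape is unary. -/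
theorem exists_code_dom_iff : ∃ c : ToPartrec.Code, ∀ k : ℕ,
    (c.eval [2 ^ k - 1]).Dom ↔ (Nat.Partrec.Code.eval (Denumerable.ofNat _ k) 0).Dom := by
  have hf : Partrec fun m => Nat.Partrec.Code.eval (Denumerable.ofNat _ (exponent m)) 0 :=
    Nat.Partrec.Code.eval_part.comp
      ((Primrec.ofNat _).to_comp.comp primrec_exponent.to_comp) (Computable.const 0)
  obtain ⟨c, hc⟩ := ToPartrec.Code.exists_code (Nat.Partrec'.part_iff₁.2 hf)
  refine ⟨c, fun k => ?_⟩
  have := hc ⟨[2 ^ k - 1], rfl⟩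
  dsimp only at this
  rw [this]
  change (Nat.Partrec.Code.eval (Denumerable.ofNat _ (exponent (2 ^ k - 1))) 0).Dom ↔ _
  rw [exponent_two_pow_sub_one]

/-- A Turing machine whose control states stay in the finite set `S` can be replaced by one with
finitely many control states. -/
theorem exists_finite_machine {Γ Λ : Type} [Inhabited Γ] [Inhabited Λ] (M : TM0.Machine Γ Λ)
    (S : Finset Λ) (hS : TM0.Supports M (S : Set Λ)) :
    ∃ (Λ' : Type) (_ : Inhabited Λ') (_ : Finite Λ') (M' : TM0.Machine Γ Λ'), ∀ l : List Γ,
      (StateTransition.eval (TM0.step M') (TM0.init l)).Dom ↔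
        (StateTransition.eval (TM0.step M) (TM0.init l)).Dom := by
  classical
  let i : Inhabited S := ⟨⟨default, hS.1⟩⟩
  let idΓ : PointedMap Γ Γ := ⟨id, rfl⟩
  let g₁ : PointedMap Λ S :=
    ⟨fun q => if h : q ∈ S then ⟨q, h⟩ else default, dif_pos (show default ∈ S from hS.1)⟩
  have hg : ∀ q ∈ (S : Set Λ), ((g₁ q : S) : Λ) = q := fun q hq =>
    congrArg Subtype.val (dif_pos (show q ∈ S from hq))
  refine ⟨S, i, inferInstance, M.map idΓ idΓ g₁ Subtype.val, fun l => ?_⟩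
  refine StateTransition.tr_eval_dom (TM0.Machine.map_respects M idΓ idΓ g₁ Subtype.val hS
    (fun _ => rfl) hg) ⟨hS.1, ?_⟩
  rw [TM0.map_init]
  simp [idΓ]

/-- There is one finite Turing machine whose halting problem on the unary inputs `a₀ a a … a` is the
halting problem for partial recursive functions. It is obtained from a universal program by
the compilations to a stack machine and to a one-tape machine. -/
theorem exists_universal_machine : ∃ (Γ Λ : Type) (_ : Inhabited Γ) (_ : Inhabited Λ)
    (_ : Finite Γ) (_ : Finite Λ) (M : TM0.Machine Γ Λ) (a₀ a : Γ), ∀ k : ℕ,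
      (StateTransition.eval (TM0.step M) (TM0.init (a₀ :: List.replicate k a))).Dom ↔
        (Nat.Partrec.Code.eval (Denumerable.ofNat _ k) 0).Dom := by
  classical
  obtain ⟨c, hc⟩ := exists_code_dom_iff
  -- The default label is where the machines start.
  let : Inhabited PartrecToTM2.Λ' := ⟨PartrecToTM2.trNormal c .halt⟩
  have hinit : ∀ v, TM2.init PartrecToTM2.K'.main (PartrecToTM2.trList v) =
      PartrecToTM2.init c v := fun v => by
    simp only [TM2.init, PartrecToTM2.init]
    congr 1
    funext k
    cases k <;> rfl
  have : Fintype PartrecToTM2.K' := ⟨{.main, .rev, .aux, .stack}, fun k => by cases k <;> simp⟩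
  let M₁ := TM2to1.tr (PartrecToTM2.tr)
  let M₀ := TM1to0.tr M₁
  have hsupp := TM1to0.tr_supports M₁ (TM2to1.tr_supports _ (PartrecToTM2.tr_supports c .halt))
  obtain ⟨Λ', _, _, M, hM⟩ := exists_finite_machine M₀ _ hsupp
  let sym : PartrecToTM2.Γ' → TM2to1.Γ' PartrecToTM2.K' (fun _ => PartrecToTM2.Γ') :=
    fun a => (false, Function.update (fun _ => none) .main (some a))
  let a₀ : TM2to1.Γ' PartrecToTM2.K' (fun _ => PartrecToTM2.Γ') :=
    (true, Function.update (fun _ => none) .main (some .cons))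
  refine ⟨_, Λ', inferInstance, inferInstance, inferInstance, inferInstance, M, a₀, sym .bit1,
    fun k => ?_⟩
  have htape : a₀ :: List.replicate k (sym .bit1) =
      TM2to1.trInit PartrecToTM2.K'.main (PartrecToTM2.trList [2 ^ k - 1]) := by
    simp only [TM2to1.trInit, PartrecToTM2.trList, trNat_two_pow_sub_one, List.reverse_append,
      List.reverse_cons, List.reverse_nil, List.nil_append, List.reverse_replicate]
    change a₀ :: _ = a₀ :: List.map sym (List.replicate k .bit1)
    rw [List.map_replicate]
  have h₁ : (StateTransition.eval (TM0.step M₀) (TM0.init (TM2to1.trInit PartrecToTM2.K'.main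
      (PartrecToTM2.trList [2 ^ k - 1])))).Dom ↔ (TM1.eval M₁ (TM2to1.trInit PartrecToTM2.K'.main
      (PartrecToTM2.trList [2 ^ k - 1]))).Dom := by
    rw [← TM1to0.tr_eval]
    exact Iff.rfl
  have h₂ : (TM2.eval PartrecToTM2.tr PartrecToTM2.K'.main
      (PartrecToTM2.trList [2 ^ k - 1])).Dom ↔ (c.eval [2 ^ k - 1]).Dom := by
    change (StateTransition.eval (TM2.step PartrecToTM2.tr) (TM2.init _ _)).Dom ↔ _
    rw [hinit, PartrecToTM2.tr_eval]
    exact Iff.rfl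
  rw [htape, hM]
  exact h₁.trans ((TM2to1.tr_eval_dom _ _ _).trans (h₂.trans (hc k)))

/-! ### Computing the inputs -/

theorem primrec_gcd : Primrec₂ Nat.gcd := by
  have hdvd : PrimrecRel fun a b : ℕ => b % a = 0 :=
    Primrec.eq.comp₂ (Primrec.nat_mod.comp₂ Primrec₂.right Primrec₂.left) (Primrec₂.const 0)
  have h : PrimrecRel fun (p : ℕ × ℕ) (d : ℕ) => p.1 % d = 0 ∧ p.2 % d = 0 :=
    PrimrecPred.and
      (hdvd.comp Primrec.snd (Primrec.fst.comp Primrec.fst))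
      (hdvd.comp Primrec.snd (Primrec.snd.comp Primrec.fst))
  refine (Primrec.nat_findGreatest (Primrec.nat_add.comp Primrec.fst Primrec.snd) h).of_eq
    fun p => Nat.findGreatest_eq_iff.2 ⟨?_, fun _ => ?_, fun n hn hn' hd => ?_⟩
  · rcases Nat.eq_zero_or_pos p.1 with h | h
    · simp [h]
    · exact (Nat.gcd_le_left _ h).trans (Nat.le_add_right _ _)
  · exact ⟨Nat.mod_eq_zero_of_dvd (Nat.gcd_dvd_left _ _),
      Nat.mod_eq_zero_of_dvd (Nat.gcd_dvd_right _ _)⟩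
  · have hg : 0 < p.1.gcd p.2 := Nat.pos_of_ne_zero fun h => by
      obtain ⟨h1, h2⟩ := Nat.gcd_eq_zero_iff.1 h
      omega
    exact absurd hn (Nat.le_of_dvd hg (Nat.dvd_gcd (Nat.dvd_of_mod_eq_zero hd.1)
      (Nat.dvd_of_mod_eq_zero hd.2))).not_gt

/-- The fraction in lowest terms is obtained by dividing by the greatest common divisor. -/
theorem codeRat_div (N : ℕ) {D : ℕ} (hD : 0 < D) :
    codeRat ((N : ℚ≥0) / D) = (N / N.gcd D, D / N.gcd D) := by
  generalize hx : (N : ℚ≥0) / D = x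
  have hD' : (D : ℚ≥0) ≠ 0 := by exact_mod_cast hD.ne'
  have h1 : x.num * D = N * x.den := by
    have h2 : (x.num : ℚ≥0) / x.den = N / D := by rw [NNRat.num_div_den, hx]
    rw [div_eq_div_iff (by exact_mod_cast x.den_ne_zero) hD'] at h2
    exact_mod_cast h2
  obtain ⟨g, rfl⟩ : x.den ∣ D :=
    x.coprime_num_den.symm.dvd_of_dvd_mul_left ⟨N, by rw [h1, mul_comm]⟩
  have hN : N = x.num * g := by
    have := x.den_pos
    nlinarith
  have hg : 0 < g := Nat.pos_of_mul_pos_left hD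
  rw [hN, Nat.gcd_mul_right, x.coprime_num_den.gcd_eq_one, one_mul, Nat.mul_div_cancel _ hg,
    Nat.mul_div_cancel _ hg, codeRat]


theorem primrec_codeRat_div {f g : ℕ → ℕ} (hf : Primrec f) (hg : Primrec g)
    (h0 : ∀ k, 0 < g k) : Primrec fun k => codeRat ((f k : ℚ≥0) / g k) := by
  have h := primrec_gcd.comp hf hg
  exact ((Primrec.nat_div.comp hf h).pair (Primrec.nat_div.comp hg h)).of_eq
    fun k => (codeRat_div _ (h0 k)).symm

/-- The numerator of the value of a stack of `k` equal symbols with digit `c`, in base `B`, over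
the denominator `B ^ k`. -/
def unaryNumerator (B c : ℕ) : ℕ → ℕ := Nat.rec 0 fun k N => c * B ^ k + N

theorem primrec_unaryNumerator (B c : ℕ) : Primrec (unaryNumerator B c) :=
  Primrec.nat_rec₁ 0 (Primrec.nat_add.comp₂
    (Primrec.nat_mul.comp₂ (Primrec₂.const c) ((primrec_pow B).comp₂ Primrec₂.left))
    Primrec₂.right)

section

variable {Γ : Type} [Inhabited Γ] (σ : SymbolCode Γ) (a₀ a : Γ)

theorem listValue_replicate (k : ℕ) :
    σ.listValue (List.replicate k a) =
      unaryNumerator σ.base (2 * σ.code a) k / ((σ.base ^ k : ℕ) : ℚ) := by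
  have hB := σ.base_pos.ne'
  induction k with
  | zero => simp [SymbolCode.listValue, unaryNumerator]
  | succ k ih =>
    change (2 * (σ.code a : ℚ) + σ.listValue (List.replicate k a)) / σ.base =
      ((2 * σ.code a * σ.base ^ k + unaryNumerator σ.base (2 * σ.code a) k : ℕ) : ℚ) / _
    rw [ih]
    push_cast
    field_simp
    ring

/-- The codes of the six counter values that represent the tape with `a₀` under the head and `k`
copies of `a` to its right. -/
theorem codeConfig_tapeVec {n : ℕ} (q : Fin n) (k : ℕ) :
    codeConfig (Config.ofVec q (tapeVec σ (Tape.mk₁ (a₀ :: List.replicate k a)))) =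
      (q.val, [(0, 1), (1, 1),
        codeRat (unaryNumerator σ.base (2 * σ.code a) k / (σ.base ^ k : ℕ)),
        codeRat ((σ.base ^ k - unaryNumerator σ.base (2 * σ.code a) k : ℕ) / (σ.base ^ k : ℕ)),
        (0, 1), (1, 1)]) := by
  have hD : (0 : ℚ) < (σ.base ^ k : ℕ) := by exact_mod_cast pow_pos σ.base_pos k
  have hr : σ.value (Tape.mk₁ (a₀ :: List.replicate k a)).right =
      unaryNumerator σ.base (2 * σ.code a) k / ((σ.base ^ k : ℕ) : ℚ) :=
    listValue_replicate σ a k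
  have hl : σ.value (Tape.mk₁ (a₀ :: List.replicate k a)).left = 0 := rfl
  have hle : unaryNumerator σ.base (2 * σ.code a) k ≤ σ.base ^ k := by
    have h := (σ.value_mem (Tape.mk₁ (a₀ :: List.replicate k a)).right).2
    rw [hr, div_le_one hD] at h
    exact_mod_cast h
  have hx : ∀ N : ℕ, ((N : ℚ) / (σ.base ^ k : ℕ)).toNNRat = (N : ℚ≥0) / (σ.base ^ k : ℕ) :=
    fun N => by
      apply NNRat.coe_injective
      rw [Rat.coe_toNNRat _ (by positivity)]
      push_cast
      rfl
  have hc : (1 : ℚ) - unaryNumerator σ.base (2 * σ.code a) k / (σ.base ^ k : ℕ) =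
      ((σ.base ^ k - unaryNumerator σ.base (2 * σ.code a) k : ℕ) : ℚ) / (σ.base ^ k : ℕ) := by
    rw [Nat.cast_sub hle, sub_div, div_self hD.ne']
  have h0 : codeRat 0 = (0, 1) := by simp [codeRat]
  have h1 : codeRat 1 = (1, 1) := by simp [codeRat]
  simp only [codeConfig, Config.ofVec, tapeVec, hr, hl, hc, arrange, List.ofFn_succ, List.ofFn_zero]
  generalize σ.base ^ k - unaryNumerator σ.base (2 * σ.code a) k = N'
  generalize σ.base ^ k = D at hx ⊢
  simp [hx, h0, h1]

end

theorem sum_tapeVec {Γ : Type} [Inhabited Γ] (σ : SymbolCode Γ) (T : Tape Γ) :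
    ∑ i, tapeVec σ T i = 3 := by
  rw [tapeVec, sum_arrange]
  ring

/-- The inputs for the simulation of a Turing machine on unary tapes can be computed: only the
counter values of the source depend on the tape. -/
theorem computable_code_simulation {Γ Λ : Type} [Inhabited Γ] [Inhabited Λ] [Finite Γ] [Finite Λ]
    (σ : SymbolCode Γ) (M : TM0.Machine Γ Λ) (s₀ : SimState Γ Λ) (c : Fin 6) (a₀ a : Γ) :
    Computable fun k : ℕ => ((simulation σ M).toInput c s₀
      (tapeVec σ (Tape.mk₁ (a₀ :: List.replicate k a)))).code := by
  have hD : Primrec fun k : ℕ => σ.base ^ k := primrec_pow σ.base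
  have hN := primrec_unaryNumerator σ.base (2 * σ.code a)
  have hD0 : ∀ k : ℕ, 0 < σ.base ^ k := fun k => pow_pos (by exact_mod_cast σ.base_pos) k
  have hx := primrec_codeRat_div hN hD hD0
  have hx' := primrec_codeRat_div (Primrec.nat_sub.comp hD hN) hD hD0
  have hsource := (Primrec.const (α := ℕ) (DrainMachine.num (some s₀)).val).pair
    ((Primrec.list_cons.comp (Primrec.const (0, 1)) (Primrec.list_cons.comp (Primrec.const (1, 1))
      (Primrec.list_cons.comp hx (Primrec.list_cons.comp hx' (Primrec.const [(0, 1), (1, 1)]))))))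
  refine Primrec.to_comp (((Primrec.const (DrainMachine.size (SimState Γ Λ))).pair
    ((Primrec.const 6).pair ((Primrec.const
      (((simulation σ M).finite_transSet c).toFinset.toList.map codeTransition)).pair
        (hsource.pair (Primrec.const (codeConfig (Config.ofVec
          (DrainMachine.num (none : Option (SimState Γ Λ)))
            (Pi.single c (3 : ℚ) : Fin 6 → ℚ)))))))).of_eq fun k => ?_)
  simp only [CoverInput.code, DrainMachine.toInput, codeConfig_tapeVec, sum_tapeVec]

end ContVASS

theorem mainTheorem4 : ¬ ContVASS.CoverabilityDecidable ContVASS.resetMatrices := by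
  rintro ⟨f, hf, hI⟩
  obtain ⟨Γ, Λ, _, _, _, _, M, a₀, a, hM⟩ := ContVASS.exists_universal_machine
  obtain ⟨σ⟩ := ContVASS.SymbolCode.nonempty_of_finite (Γ := Γ)
  refine ComputablePred.halting_problem 0 (ComputablePred.computable_iff.2
    ⟨_, hf.comp ((ContVASS.computable_code_simulation σ M (.main default a₀) 5 a₀ a).comp
      Computable.encode), ?_⟩)
  funext c
  rw [hI, ContVASS.DrainMachine.toInput_holds_iff _ _ _ (ContVASS.tapeVec_nonneg _)]
  refine propext (Iff.symm ?_)
  have h := ContVASS.simulation_halts_iff (σ := σ) (M := M)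
    (Turing.TM0.init (a₀ :: List.replicate (Encodable.encode c) a))
  rw [hM, Denumerable.ofNat_encode] at h
  exact h
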